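/- For $\theta\in\mathbb R$ let $|\theta_\pm\rangle=\cos\theta\,|0\rangle\pm\sin\theta\,|1\rangle$ and let $\mathcal S_\theta=\{|\psi_1\rangle,\dots,|\psi_4\rangle\}$ be the bipartite ensemble $$|\psi_1\rangle=|\theta_+\rangle_A|\theta_+\rangle_B,\quad |\psi_2\rangle=|\theta_+\rangle_A|\theta_-\rangle_B,\quad |\psi_3\rangle=|\theta_-\rangle_A|\theta_+\rangle_B,\quad |\psi_4\rangle=|\theta_-\rangle_A|\theta_-\rangle_B .$$ An ensemble $\{|\psi_i\rangle_{AB}\}_{i=1}^N$ admits $(n,m)$-LSAM (local state antimarking) if there is a finite-round LOCC protocol which, given $|\psi_{i_1}\rangle_{A_1B_1}\otimes\dots\otimes|\psi_{i_n}\rangle_{A_nB_n}$ for an unknown sequence $(i_1,\dots,i_n)$ of pairwise distinct indices (Alice holding $A_1\dots A_n$ and Bob $B_1\dots B_n$), declares in every run that occurs with non-zero probability a set of at least $m$ sequences of pairwise distinct indices that does not contain $(i_1,\dots,i_n)$. It admits it in the strong sense if the protocol can be chosen such that, moreover, every sequence belongs to some declared set that occurs with non-zero probability on some input sequence. Suppose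 that $0<|\cos 2\theta|\le\sqrt2-1$. Then: 1. $\mathcal S_\theta$ does not admit $(1,2)$-LSAM. 2. $\mathcal S_\theta$ admits $(2,8)$-LSAM, even in the strong sense. 3. If $\cos2\theta>0$, then with $|{\pm\bar\theta}\rangle=\sin\theta|0\rangle\mp\cos\theta|1\rangle$, $|\psi_{01}^\pm\rangle=|01\rangle\pm|10\rangle$, $|\psi_{cs}^\pm\rangle=\sin^2\theta|00\rangle\pm\cos^2\theta|11\rangle$, $\beta=\frac1{2\cos^4\theta}$, $\gamma=\frac{1-\tan^4\theta}{4\sin^2\theta}$, $\alpha=\frac12-\gamma\cos^2\theta$, the six operators $$\Pi_A=\gamma|{+\bar\theta},0\rangle\langle{+\bar\theta},0|,\quad \Pi_B=\gamma|0,{+\bar\theta}\rangle\langle 0,{+\bar\theta}|,\quad \Pi_C=\gamma|0,{-\bar\theta}\rangle\langle 0,{-\bar\theta}|,\quad \Pi_D=\gamma|{-\bar\theta},0\rangle\langle{-\bar\theta},0|,$$ $$\Pi_E=\alpha|\psi_{01}^+\rangle\langle\psi_{01}^+|+\beta|\psi_{cs}^+\rangle\langle\psi_{cs}^+|,\qquad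 \Pi_F=\alpha|\psi_{01}^-\rangle\langle\psi_{01}^-|+\beta|\psi_{cs}^-\rangle\langle\psi_{cs}^-|$$ form a POVM on $\mathbb C^2\otimes\mathbb C^2$. If Alice measures it on $A_1A_2$ and Bob measures it on $B_1B_2$, then for each of the 36 joint outcomes at least eight of the twelve sequences $(i,j)$, $i\ne j$, have probability zero of producing that outcome. -/

import Mathlib

open scoped Matrix Kronecker ComplexOrder

noncomputable section

/-- Alice applies the operator `M` to her subsystem of a bipartite vector: `(M ⊗ 1) v`. -/
def actA {α α' β : Type} [Fintype α] (M : Matrix α' α ℂ) (v : α × β → ℂ) : α' × β → ℂ :=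
  fun p => ∑ a, M p.1 a * v (a, p.2)

/-- Bob applies the operator `M` to his subsystem of a bipartite vector: `(1 ⊗ M) v`. -/
def actB {α β β' : Type} [Fintype β] (M : Matrix β' β ℂ) (v : α × β → ℂ) : α × β' → ℂ :=
  fun p => ∑ b, M p.2 b * v (p.1, b)

/-- A (finite-round, two-party) LOCC protocol with final declarations in `Ω`, on the bipartite
system `ℂ^α ⊗ ℂ^β`. Either the parties stop and declare `x : Ω`, or one of them performs a local
measurement with Kraus operators `M k` (`∑ k, (M k)ᴴ * M k = 1`, the output system `α' k` may be
any finite-dimensional one) and announces the outcome `k`, whereupon they continue with the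
protocol `next k`. An outcome that is discarded or merged with others is one on which `next` does
not depend; randomness is a measurement with Kraus operators proportional to the identity. -/
inductive LOCC (Ω : Type) : Type → Type → Type 1
  | output {α β : Type} (x : Ω) : LOCC Ω α β
  | alice {α β : Type} [DecidableEq α] (r : ℕ) (α' : Fin r → Type) [∀ k, Fintype (α' k)]
      (M : ∀ k, Matrix (α' k) α ℂ) (hM : ∑ k, (M k)ᴴ * M k = 1)
      (next : ∀ k, LOCC Ω (α' k) β) : LOCC Ω α β
  | bob {α β : Type} [DecidableEq β] (r : ℕ) (β' : Fin r → Type) [∀ k, Fintype (β' k)]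
      (M : ∀ k, Matrix (β' k) β ℂ) (hM : ∑ k, (M k)ᴴ * M k = 1)
      (next : ∀ k, LOCC Ω α (β' k)) : LOCC Ω α β

open Classical in
/-- The probability that the protocol, run on the pure state `v`, ends with the declaration `x`
(the squared norms of the unnormalised final vectors, summed over all runs that declare `x`). -/
def LOCC.prob {Ω : Type} : {α β : Type} → [Fintype α] → [Fintype β] →
    LOCC Ω α β → (α × β → ℂ) → Ω → ℝ
  | _, _, _, _, .output y, v, x => if y = x then ∑ p, ‖v p‖ ^ 2 else 0
  | _, _, _, _, @LOCC.alice _ _ _ _ _ _ _ M _ next, v, x => ∑ k, (next k).prob (actA (M k) v) x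
  | _, _, _, _, @LOCC.bob _ _ _ _ _ _ _ M _ next, v, x => ∑ k, (next k).prob (actB (M k) v) x

/-- For a bipartite ensemble `ψ` and a non-repetitive sequence of indices `x = (x₁, …, xₙ)`, the
state `ψ_{x₁} ⊗ ⋯ ⊗ ψ_{xₙ}`, with its tensor factors arranged as `A₁…Aₙ | B₁…Bₙ`. -/
def seqState {ι α β : Type} {n : ℕ} (ψ : ι → α × β → ℂ) (x : Fin n ↪ ι) :
    (Fin n → α) × (Fin n → β) → ℂ :=
  fun p => ∏ t, ψ (x t) (p.1 t, p.2 t)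

/-- The protocol perfectly eliminates at least `m` sequences in every run: whenever the set `X`
is declared with non-zero probability on the sequence `x`, it consists of at least `m`
(non-repetitive) sequences, none of which is `x`. -/
def LOCC.Antimarks {ι α β : Type} [Fintype α] [Fintype β] {n : ℕ}
    (P : LOCC (Finset (Fin n ↪ ι)) (Fin n → α) (Fin n → β)) (ψ : ι → α × β → ℂ) (m : ℕ) : Prop :=
  ∀ (x : Fin n ↪ ι) (X : Finset (Fin n ↪ ι)),
    P.prob (seqState ψ x) X ≠ 0 → m ≤ X.card ∧ x ∉ X

/-- The ensemble `ψ` admits `(n, m)`-LSAM (local state antimarking). -/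
def IsLSAM {ι α β : Type} [Fintype α] [Fintype β] (ψ : ι → α × β → ℂ) (n m : ℕ) : Prop :=
  ∃ P : LOCC (Finset (Fin n ↪ ι)) (Fin n → α) (Fin n → β), P.Antimarks ψ m

/-- `(n, m)`-LSAM in the strong sense: in addition, every sequence belongs to some declaration
that does occur with non-zero probability, so that no sequence is impossible to rule out. -/
def IsStrongLSAM {ι α β : Type} [Fintype α] [Fintype β] (ψ : ι → α × β → ℂ) (n m : ℕ) : Prop :=
  ∃ P : LOCC (Finset (Fin n ↪ ι)) (Fin n → α) (Fin n → β), P.Antimarks ψ m ∧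
    ∀ x : Fin n ↪ ι, ∃ (X : Finset (Fin n ↪ ι)) (y : Fin n ↪ ι),
      x ∈ X ∧ P.prob (seqState ψ y) X ≠ 0

theorem IsStrongLSAM.isLSAM {ι α β : Type} [Fintype α] [Fintype β] {ψ : ι → α × β → ℂ}
    {n m : ℕ} (h : IsStrongLSAM ψ n m) : IsLSAM ψ n m :=
  let ⟨P, hP, _⟩ := h
  ⟨P, hP⟩

/-- `|θ₊⟩ = cos θ |0⟩ + sin θ |1⟩`. -/
def thetaPlus (θ : ℝ) : Fin 2 → ℂ := ![(Real.cos θ : ℂ), (Real.sin θ : ℂ)]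

/-- `|θ₋⟩ = cos θ |0⟩ - sin θ |1⟩`. -/
def thetaMinus (θ : ℝ) : Fin 2 → ℂ := ![(Real.cos θ : ℂ), -(Real.sin θ : ℂ)]

/-- The product vector `u ⊗ v`, with `u` held by Alice and `v` by Bob. -/
def prodAB (u v : Fin 2 → ℂ) : Fin 2 × Fin 2 → ℂ := fun p => u p.1 * v p.2

/-- The ensemble `|θ₊⟩|θ₊⟩, |θ₊⟩|θ₋⟩, |θ₋⟩|θ₊⟩, |θ₋⟩|θ₋⟩`. -/
def thetaEnsemble (θ : ℝ) : Fin 4 → Fin 2 × Fin 2 → ℂ :=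
  ![prodAB (thetaPlus θ) (thetaPlus θ), prodAB (thetaPlus θ) (thetaMinus θ),
    prodAB (thetaMinus θ) (thetaPlus θ), prodAB (thetaMinus θ) (thetaMinus θ)]

/-- The product vector `u ⊗ v` of the two qubits that one and the same party holds. -/
def ket2 (u v : Fin 2 → ℂ) : (Fin 2 → Fin 2) → ℂ := fun s => u (s 0) * v (s 1)

/-- `|w⟩⟨w|`. -/
def outer {α : Type} (w : α → ℂ) : Matrix α α ℂ := Matrix.vecMulVec w (star w)

/-- `|0⟩`. -/
def ket0 : Fin 2 → ℂ := ![1, 0]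

/-- `|1⟩`. -/
def ket1 : Fin 2 → ℂ := ![0, 1]

/-- `|+θ̄⟩ = sin θ |0⟩ - cos θ |1⟩`, orthogonal to `|θ₊⟩`. -/
def thetaBarPlus (θ : ℝ) : Fin 2 → ℂ := ![(Real.sin θ : ℂ), -(Real.cos θ : ℂ)]

/-- `|-θ̄⟩ = sin θ |0⟩ + cos θ |1⟩`, orthogonal to `|θ₋⟩`. -/
def thetaBarMinus (θ : ℝ) : Fin 2 → ℂ := ![(Real.sin θ : ℂ), (Real.cos θ : ℂ)]

/-- `|01⟩ + ε |10⟩`. -/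
def psi01 (ε : ℂ) : (Fin 2 → Fin 2) → ℂ := ket2 ket0 ket1 + ε • ket2 ket1 ket0

/-- `sin² θ |00⟩ + ε cos² θ |11⟩`. -/
def psiCS (θ : ℝ) (ε : ℂ) : (Fin 2 → Fin 2) → ℂ :=
  ((Real.sin θ ^ 2 : ℝ) : ℂ) • ket2 ket0 ket0 +
    (ε * ((Real.cos θ ^ 2 : ℝ) : ℂ)) • ket2 ket1 ket1

def povmBeta (θ : ℝ) : ℝ := 1 / (2 * Real.cos θ ^ 4)

def povmGamma (θ : ℝ) : ℝ := (1 - Real.tan θ ^ 4) / (4 * Real.sin θ ^ 2)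

def povmAlpha (θ : ℝ) : ℝ := 1 / 2 - povmGamma θ * Real.cos θ ^ 2

/-- The six operators `Π_A, …, Π_F` of the measurement performed by each party. -/
def thetaPOVM (θ : ℝ) : Fin 6 → Matrix (Fin 2 → Fin 2) (Fin 2 → Fin 2) ℂ :=
  ![(povmGamma θ : ℂ) • outer (ket2 (thetaBarPlus θ) ket0),
    (povmGamma θ : ℂ) • outer (ket2 ket0 (thetaBarPlus θ)),
    (povmGamma θ : ℂ) • outer (ket2 ket0 (thetaBarMinus θ)),
    (povmGamma θ : ℂ) • outer (ket2 (thetaBarMinus θ) ket0),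
    (povmAlpha θ : ℂ) • outer (psi01 1) + (povmBeta θ : ℂ) • outer (psiCS θ 1),
    (povmAlpha θ : ℂ) • outer (psi01 (-1)) + (povmBeta θ : ℂ) • outer (psiCS θ (-1))]

/-- `E` is a positive operator-valued measure. -/
def IsPOVM {α κ : Type} [Fintype α] [DecidableEq α] [Fintype κ] (E : κ → Matrix α α ℂ) : Prop :=
  (∀ k, (E k).PosSemidef) ∧ ∑ k, E k = 1

/-- Born rule: `⟨v| E ⊗ F |v⟩`, the probability that Alice's outcome has the operator `E` and
Bob's the operator `F`. -/
def bornProb {α β : Type} [Fintype α] [Fintype β] (E : Matrix α α ℂ) (F : Matrix β β ℂ)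
    (v : α × β → ℂ) : ℂ :=
  star v ⬝ᵥ ((E ⊗ₖ F) *ᵥ v)

end

/-! ### Non-orthogonal local states cannot be eliminated by LOCC -/

/-! Every state is a product whose two factors carry independent signs, and `|θ₊⟩`, `|θ₋⟩` overlap
by `cos 2θ ≠ 0`. A local measurement preserves the sum over outcomes of the inner products, so some
outcome keeps the two states non-orthogonal. Following such outcomes leads to a run that is possible
for all four states, so nothing can be eliminated on one copy (`LOCC.exists_prob_ne_zero`).

On two copies, each of the six operators annihilates two of a party's four sign pairs
(`thetaPOVM_mulVec_eq_zero`): those with a given first sign, a given second sign, unequal signs or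
equal signs. A joint outcome thus spares at most 2·2 of the 16 index pairs, hence rules out at least
12 - 4 = 8 of the non-repetitive ones. Positivity of the operators is what requires `0 < cos 2θ ≤ √2
- 1`; negative `cos 2θ` is reduced to this by exchanging `|0⟩` and `|1⟩`. -/

theorem actA_mul {α α' β : Type} [Fintype α] (M : Matrix α' α ℂ) (u : α → ℂ) (v : β → ℂ) :
    actA M (fun p => u p.1 * v p.2) = fun p => (M *ᵥ u) p.1 * v p.2 := by
  funext p
  simp only [actA, Matrix.mulVec, dotProduct, Finset.sum_mul]
  exact Finset.sum_congr rfl fun _ _ => by ring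

theorem actB_mul {α β β' : Type} [Fintype β] (M : Matrix β' β ℂ) (u : α → ℂ) (v : β → ℂ) :
    actB M (fun p => u p.1 * v p.2) = fun p => u p.1 * (M *ᵥ v) p.2 := by
  funext p
  simp only [actB, Matrix.mulVec, dotProduct, Finset.mul_sum]
  exact Finset.sum_congr rfl fun _ _ => by ring

theorem LOCC.prob_nonneg {Ω α β : Type} [iα : Fintype α] [iβ : Fintype β] (P : LOCC Ω α β)
    (v : α × β → ℂ) (x : Ω) : 0 ≤ P.prob v x := by
  induction P generalizing iα iβ with
  | output y =>
    simp only [LOCC.prob]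
    split_ifs
    · exact Finset.sum_nonneg fun _ _ => by positivity
    · exact le_rfl
  | alice r α' M hM next ih =>
    simp only [LOCC.prob]
    exact Finset.sum_nonneg fun k _ => ih k _
  | bob r β' M hM next ih =>
    simp only [LOCC.prob]
    exact Finset.sum_nonneg fun k _ => ih k _

/-- Some outcome of a measurement keeps two non-orthogonal states non-orthogonal. -/
theorem exists_dotProduct_mulVec_ne_zero {α : Type} [Fintype α] [DecidableEq α] {r : ℕ}
    {α' : Fin r → Type} [∀ k, Fintype (α' k)] (M : ∀ k, Matrix (α' k) α ℂ)
    (hM : ∑ k, (M k)ᴴ * M k = 1) {u v : α → ℂ} (h : star u ⬝ᵥ v ≠ 0) :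
    ∃ k, star (M k *ᵥ u) ⬝ᵥ (M k *ᵥ v) ≠ 0 := by
  by_contra! hk
  apply h
  calc star u ⬝ᵥ v = star u ⬝ᵥ ((∑ k, (M k)ᴴ * M k) *ᵥ v) := by rw [hM, Matrix.one_mulVec]
    _ = ∑ k, star (M k *ᵥ u) ⬝ᵥ (M k *ᵥ v) := by
      rw [Matrix.sum_mulVec, dotProduct_sum]
      refine Finset.sum_congr rfl fun k _ => ?_
      rw [Matrix.star_mulVec, ← Matrix.dotProduct_mulVec, Matrix.mulVec_mulVec]
    _ = 0 := Finset.sum_eq_zero fun k _ => hk k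

theorem ne_zero_of_star_dotProduct_ne_zero {α : Type} [Fintype α] {u : Fin 2 → α → ℂ}
    (h : star (u 0) ⬝ᵥ u 1 ≠ 0) (a : Fin 2) : u a ≠ 0 := by
  intro ha
  apply h
  fin_cases a
  · simp_all
  · simp_all

/-- A measurement by one party leaves the other's vectors unchanged, so an outcome chosen to keep
that party's own pair non-orthogonal serves all four combinations `(a, b)` at once. At the end all
the vectors are nonzero. -/
theorem LOCC.exists_prob_ne_zero {Ω α β : Type} [iα : Fintype α] [iβ : Fintype β]
    (P : LOCC Ω α β) (u : Fin 2 → α → ℂ) (v : Fin 2 → β → ℂ)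
    (hu : star (u 0) ⬝ᵥ u 1 ≠ 0) (hv : star (v 0) ⬝ᵥ v 1 ≠ 0) :
    ∃ x, ∀ a b, P.prob (fun p => u a p.1 * v b p.2) x ≠ 0 := by
  induction P generalizing iα iβ with
  | output y =>
    refine ⟨y, fun a b => ?_⟩
    obtain ⟨i, hi⟩ := Function.ne_iff.1 (ne_zero_of_star_dotProduct_ne_zero hu a)
    obtain ⟨j, hj⟩ := Function.ne_iff.1 (ne_zero_of_star_dotProduct_ne_zero hv b)
    simp only [LOCC.prob, if_true]
    refine (Finset.sum_pos' (fun _ _ => by positivity) ⟨(i, j), Finset.mem_univ _, ?_⟩).ne'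
    have : u a i * v b j ≠ 0 := mul_ne_zero hi hj
    positivity
  | alice r α' M hM next ih =>
    obtain ⟨k, hk⟩ := exists_dotProduct_mulVec_ne_zero M hM hu
    obtain ⟨x, hx⟩ := ih k (fun a => M k *ᵥ u a) v hk hv
    refine ⟨x, fun a b => ?_⟩
    simp only [LOCC.prob, actA_mul]
    exact (Finset.sum_pos' (fun _ _ => LOCC.prob_nonneg _ _ _)
      ⟨k, Finset.mem_univ _, (LOCC.prob_nonneg _ _ _).lt_of_ne' (hx a b)⟩).ne'
  | bob r β' M hM next ih =>
    obtain ⟨k, hk⟩ := exists_dotProduct_mulVec_ne_zero M hM hv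
    obtain ⟨x, hx⟩ := ih k u (fun b => M k *ᵥ v b) hu hk
    refine ⟨x, fun a b => ?_⟩
    simp only [LOCC.prob, actB_mul]
    exact (Finset.sum_pos' (fun _ _ => LOCC.prob_nonneg _ _ _)
      ⟨k, Finset.mem_univ _, (LOCC.prob_nonneg _ _ _).lt_of_ne' (hx a b)⟩).ne'

/-! ### The ensemble in terms of sign bits -/

/-- `|θ₊⟩` and `|θ₋⟩`, indexed by a bit. -/
noncomputable def thetaKet (θ : ℝ) : Fin 2 → Fin 2 → ℂ := ![thetaPlus θ, thetaMinus θ]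

/-- The sign of Alice's factor of the `i`-th state. -/
def aliceBit : Fin 4 → Fin 2 := ![0, 0, 1, 1]

/-- The sign of Bob's factor of the `i`-th state. -/
def bobBit : Fin 4 → Fin 2 := ![0, 1, 0, 1]

theorem thetaEnsemble_apply (θ : ℝ) (i : Fin 4) :
    thetaEnsemble θ i = prodAB (thetaKet θ (aliceBit i)) (thetaKet θ (bobBit i)) := by
  fin_cases i <;> rfl

theorem seqState_thetaEnsemble_two (θ : ℝ) (x : Fin 2 ↪ Fin 4) :
    seqState (thetaEnsemble θ) x = fun p =>
      ket2 (thetaKet θ (aliceBit (x 0))) (thetaKet θ (aliceBit (x 1))) p.1 *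
        ket2 (thetaKet θ (bobBit (x 0))) (thetaKet θ (bobBit (x 1))) p.2 := by
  funext p
  simp only [seqState, thetaEnsemble_apply, Fin.prod_univ_two, prodAB, ket2]
  ring

theorem star_thetaKet_dotProduct (θ : ℝ) :
    star (thetaKet θ 0) ⬝ᵥ thetaKet θ 1 = (Real.cos (2 * θ) : ℂ) := by
  simp only [thetaKet, thetaPlus, thetaMinus, dotProduct, Fin.sum_univ_two, Pi.star_apply,
    Matrix.cons_val_zero, Matrix.cons_val_one, Complex.star_def, Complex.conj_ofReal,
    Real.cos_two_mul']
  push_cast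
  ring

theorem sum_fin_one_arrow {M : Type*} [AddCommMonoid M] (f : (Fin 1 → Fin 2) → M) :
    ∑ s, f s = ∑ a, f fun _ => a :=
  (Equiv.sum_comp (Equiv.funUnique (Fin 1) (Fin 2)).symm f).symm

theorem sum_fin_two_arrow {M : Type*} [AddCommMonoid M] (f : (Fin 2 → Fin 2) → M) :
    ∑ s, f s = ∑ a, ∑ b, f ![a, b] := by
  rw [← Equiv.sum_comp (finTwoArrowEquiv (Fin 2)).symm f, Fintype.sum_prod_type]
  rfl

theorem not_isLSAM_thetaEnsemble_one (θ : ℝ) (hθ : Real.cos (2 * θ) ≠ 0) {m : ℕ} (hm : 0 < m) :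
    ¬ IsLSAM (thetaEnsemble θ) 1 m := by
  rintro ⟨P, hP⟩
  have h : star (fun s : Fin 1 → Fin 2 => thetaKet θ 0 (s 0)) ⬝ᵥ
      (fun s => thetaKet θ 1 (s 0)) ≠ 0 := by
    have := star_thetaKet_dotProduct θ
    simp only [dotProduct, Pi.star_apply] at this
    simp only [dotProduct, sum_fin_one_arrow, Pi.star_apply, this]
    exact_mod_cast hθ
  obtain ⟨X, hX⟩ := P.exists_prob_ne_zero (fun a s => thetaKet θ a (s 0))
    (fun a s => thetaKet θ a (s 0)) h h
  -- The declaration `X` is possible on every input, so it must avoid every sequence and yet be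
  -- nonempty.
  have key (x : Fin 1 ↪ Fin 4) : m ≤ X.card ∧ x ∉ X := by
    apply hP
    convert hX (aliceBit (x 0)) (bobBit (x 0)) using 2
    funext p
    simp [seqState, thetaEnsemble_apply, prodAB]
  have hcard := (key ⟨fun _ => 0, Function.injective_of_subsingleton _⟩).1
  obtain ⟨x, hx⟩ := Finset.card_pos.1 (hm.trans_le hcard)
  exact (key x).2 hx

/-! ### LOCC protocols from a pair of local measurements -/

theorem bornProb_conjTranspose_mul_self {α β α' β' : Type} [Fintype α] [Fintype β] [Fintype α']
    [Fintype β'] (M : Matrix α' α ℂ) (N : Matrix β' β ℂ) (v : α × β → ℂ) :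
    bornProb (Mᴴ * M) (Nᴴ * N) v = ((∑ p, ‖actB N (actA M v) p‖ ^ 2 : ℝ) : ℂ) := by
  have h : actB N (actA M v) = (M ⊗ₖ N) *ᵥ v := by
    funext p
    simp only [actA, actB, Matrix.mulVec, dotProduct, Matrix.kroneckerMap_apply,
      Fintype.sum_prod_type, Finset.mul_sum]
    rw [Finset.sum_comm]
    exact Finset.sum_congr rfl fun _ _ => Finset.sum_congr rfl fun _ _ => by ring
  rw [h, bornProb, Matrix.mul_kronecker_mul, ← Matrix.conjTranspose_kronecker,
    ← Matrix.mulVec_mulVec, Matrix.dotProduct_mulVec, ← Matrix.star_mulVec]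
  simp only [dotProduct, Pi.star_apply, Complex.star_def]
  push_cast
  exact Finset.sum_congr rfl fun _ _ => Complex.conj_mul' _

open scoped MatrixOrder Matrix.Norms.L2Operator in
theorem Matrix.PosSemidef.exists_eq_conjTranspose_mul_self {α : Type} [Fintype α]
    {A : Matrix α α ℂ} (hA : A.PosSemidef) : ∃ M : Matrix α α ℂ, A = Mᴴ * M := by
  classical
  exact CStarAlgebra.nonneg_iff_eq_star_mul_self.mp hA.nonneg

/-- Factoring each operator as `Mᴴ * M` supplies Kraus operators; Alice measures, then Bob, and the
pair of outcomes fixes the declaration. -/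
theorem exists_locc_prob_eq {Ω α β : Type} [DecidableEq Ω] [Fintype α] [Fintype β] [DecidableEq α]
    [DecidableEq β] {r s : ℕ} {E : Fin r → Matrix α α ℂ} {F : Fin s → Matrix β β ℂ}
    (hE : IsPOVM E) (hF : IsPOVM F) (X : Fin r → Fin s → Ω) :
    ∃ P : LOCC Ω α β, ∀ v x, (P.prob v x : ℂ) =
      ∑ k, ∑ l, if X k l = x then bornProb (E k) (F l) v else 0 := by
  have sqrtE (k) : ∃ M : Matrix α α ℂ, E k = Mᴴ * M :=
    (hE.1 k).exists_eq_conjTranspose_mul_self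
  have sqrtF (l) : ∃ N : Matrix β β ℂ, F l = Nᴴ * N :=
    (hF.1 l).exists_eq_conjTranspose_mul_self
  choose M hM using sqrtE
  choose N hN using sqrtF
  refine ⟨.alice r (fun _ => α) M (by rw [← hE.2]; simp only [hM]) fun k =>
    .bob s (fun _ => β) N (by rw [← hF.2]; simp only [hN]) fun l => .output (X k l), ?_⟩
  intro v x
  simp only [LOCC.prob, Complex.ofReal_sum]
  refine Finset.sum_congr rfl fun k _ => Finset.sum_congr rfl fun l _ => ?_
  by_cases h : X k l = x
  · rw [if_pos h, if_pos h, hM, hN, bornProb_conjTranspose_mul_self]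
  · rw [if_neg h, if_neg h, Complex.ofReal_zero]

theorem IsPOVM.bornProb_nonneg {α β κ κ' : Type} [Fintype α] [Fintype β] [DecidableEq α]
    [DecidableEq β] [Fintype κ] [Fintype κ'] {E : κ → Matrix α α ℂ} {F : κ' → Matrix β β ℂ}
    (hE : IsPOVM E) (hF : IsPOVM F) (k : κ) (l : κ') (v : α × β → ℂ) :
    0 ≤ bornProb (E k) (F l) v :=
  ((hE.1 k).kronecker (hF.1 l)).dotProduct_mulVec_nonneg v

theorem isStrongLSAM_of_isPOVM {ι α β : Type} [Fintype α] [Fintype β] [DecidableEq α]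
    [DecidableEq β] {n m r s : ℕ} {ψ : ι → α × β → ℂ}
    {E : Fin r → Matrix (Fin n → α) (Fin n → α) ℂ} {F : Fin s → Matrix (Fin n → β) (Fin n → β) ℂ}
    (hE : IsPOVM E) (hF : IsPOVM F) (X : Fin r → Fin s → Finset (Fin n ↪ ι))
    (hcard : ∀ k l, m ≤ (X k l).card)
    (hzero : ∀ k l, ∀ x ∈ X k l, bornProb (E k) (F l) (seqState ψ x) = 0)
    (hne : ∀ x, ∃ k l y, x ∈ X k l ∧ bornProb (E k) (F l) (seqState ψ y) ≠ 0) :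
    IsStrongLSAM ψ n m := by
  classical
  obtain ⟨P, hP⟩ := exists_locc_prob_eq hE hF X
  refine ⟨P, fun x Y hY => ?_, fun x => ?_⟩
  · have hY' : (P.prob (seqState ψ x) Y : ℂ) ≠ 0 := by exact_mod_cast hY
    rw [hP] at hY'
    obtain ⟨k, -, hk⟩ := Finset.exists_ne_zero_of_sum_ne_zero hY'
    obtain ⟨l, -, hl⟩ := Finset.exists_ne_zero_of_sum_ne_zero hk
    obtain ⟨rfl, hkl⟩ := ite_ne_right_iff.1 hl
    exact ⟨hcard k l, fun hx => hkl (hzero k l x hx)⟩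
  · obtain ⟨k, l, y, hx, hy⟩ := hne x
    refine ⟨X k l, y, hx, fun h0 => hy ?_⟩
    have hsum := hP (seqState ψ y) (X k l)
    -- Several outcome pairs may declare the same set; nonnegativity prevents their contributions
    -- from cancelling.
    have hnn (k' l') : 0 ≤ if X k' l' = X k l then bornProb (E k') (F l') (seqState ψ y) else 0 := by
      split_ifs
      · exact hE.bornProb_nonneg hF _ _ _
      · exact le_rfl
    rw [h0, Complex.ofReal_zero, eq_comm,
      Finset.sum_eq_zero_iff_of_nonneg fun k' _ => Finset.sum_nonneg fun l' _ => hnn k' l'] at hsum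
    have hk := hsum k (Finset.mem_univ _)
    rw [Finset.sum_eq_zero_iff_of_nonneg fun l' _ => hnn k l'] at hk
    simpa using hk l (Finset.mem_univ _)

/-! ### The six-outcome measurement -/

theorem posSemidef_outer {α : Type} [Finite α] (w : α → ℂ) : (outer w).PosSemidef :=
  Matrix.posSemidef_vecMulVec_self_star w

/-- With `C = cos 2θ`, the last inequality reads `C ≤ (1 - C²) / 2`, that is `(C + 1)² ≤ 2`. It is
exactly what `0 ≤ povmAlpha θ` needs. -/
theorem sin_sq_cos_sq_bounds {θ : ℝ} (h0 : 0 < Real.cos (2 * θ))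
    (h1 : Real.cos (2 * θ) ≤ √2 - 1) :
    0 < Real.sin θ ^ 2 ∧ Real.sin θ ^ 2 < Real.cos θ ^ 2 ∧
      (Real.cos θ ^ 2) ^ 2 - (Real.sin θ ^ 2) ^ 2 ≤ 2 * Real.sin θ ^ 2 * Real.cos θ ^ 2 := by
  have hs := Real.sin_sq_add_cos_sq θ
  have h2 : √2 ^ 2 = 2 := Real.sq_sqrt (by norm_num)
  have h2' : √2 < 2 := by nlinarith [Real.sqrt_nonneg 2]
  rw [Real.cos_two_mul'] at h0 h1
  refine ⟨by nlinarith, by linarith, ?_⟩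
  nlinarith [Real.sqrt_nonneg 2]

theorem povmGamma_eq {θ : ℝ} (hc : Real.cos θ ≠ 0) : povmGamma θ =
    ((Real.cos θ ^ 2) ^ 2 - (Real.sin θ ^ 2) ^ 2) /
      (4 * Real.sin θ ^ 2 * (Real.cos θ ^ 2) ^ 2) := by
  rw [povmGamma, Real.tan_eq_sin_div_cos]
  -- Here both denominators vanish, and both sides are `0` by convention.
  by_cases hs : Real.sin θ = 0
  · simp [hs]
  · field_simp

theorem povmGamma_pos {θ : ℝ} (h0 : 0 < Real.cos (2 * θ)) (h1 : Real.cos (2 * θ) ≤ √2 - 1) :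
    0 < povmGamma θ := by
  obtain ⟨hs, hsc, -⟩ := sin_sq_cos_sq_bounds h0 h1
  have hc : Real.cos θ ≠ 0 := fun h => by rw [h] at hsc; nlinarith
  rw [povmGamma_eq hc]
  have : 0 < (Real.cos θ ^ 2) ^ 2 - (Real.sin θ ^ 2) ^ 2 := by nlinarith
  positivity

theorem povmAlpha_nonneg {θ : ℝ} (h0 : 0 < Real.cos (2 * θ)) (h1 : Real.cos (2 * θ) ≤ √2 - 1) :
    0 ≤ povmAlpha θ := by
  obtain ⟨hs, hsc, hb⟩ := sin_sq_cos_sq_bounds h0 h1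
  have hc : 0 < Real.cos θ ^ 2 := hs.trans hsc
  have hc' : Real.cos θ ≠ 0 := fun h => by rw [h] at hc; simp at hc
  rw [povmAlpha, povmGamma_eq hc', sub_nonneg, div_mul_eq_mul_div, div_le_iff₀ (by positivity)]
  nlinarith

theorem thetaPOVM_sum {θ : ℝ} (hs : Real.sin θ ≠ 0) (hc : Real.cos θ ≠ 0) :
    ∑ k, thetaPOVM θ k = 1 := by
  -- The three identities are the diagonal entries at `11`, at `00`, and at `01` and `10`; off the
  -- diagonal, terms of opposite sign cancel.
  have hβ : 2 * povmBeta θ * Real.cos θ ^ 4 = 1 := by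
    rw [povmBeta]; field_simp
  have hγ : 4 * povmGamma θ * Real.sin θ ^ 2 + 2 * povmBeta θ * Real.sin θ ^ 4 = 1 := by
    rw [povmGamma_eq hc, povmBeta]; field_simp; ring
  have hα : 2 * povmAlpha θ + 2 * povmGamma θ * Real.cos θ ^ 2 = 1 := by
    rw [povmAlpha]; ring
  have hβ' := congrArg (fun r : ℝ => (r : ℂ)) hβ
  have hγ' := congrArg (fun r : ℝ => (r : ℂ)) hγ
  have hα' := congrArg (fun r : ℝ => (r : ℂ)) hα
  simp only [Complex.ofReal_add, Complex.ofReal_mul, Complex.ofReal_pow, Complex.ofReal_ofNat,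
    Complex.ofReal_one] at hβ' hγ' hα'
  ext s t
  obtain ⟨⟨a, b⟩, rfl⟩ := (finTwoArrowEquiv (Fin 2)).symm.surjective s
  obtain ⟨⟨c, d⟩, rfl⟩ := (finTwoArrowEquiv (Fin 2)).symm.surjective t
  rw [Matrix.one_apply]
  simp only [EmbeddingLike.apply_eq_iff_eq, Prod.mk.injEq]
  simp only [Fin.sum_univ_six, thetaPOVM, outer, Matrix.add_apply, Matrix.smul_apply,
    Matrix.vecMulVec_apply, Matrix.cons_val, finTwoArrowEquiv_symm_apply, ket2, psi01, psiCS,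
    Pi.star_apply, Pi.add_apply, Pi.smul_apply, smul_eq_mul]
  fin_cases a <;> fin_cases b <;> fin_cases c <;> fin_cases d <;>
    simp [ket0, ket1, thetaBarPlus, thetaBarMinus, -Complex.ofReal_cos, -Complex.ofReal_sin] <;>
    grind

theorem isPOVM_thetaPOVM {θ : ℝ} (h0 : 0 < Real.cos (2 * θ)) (h1 : Real.cos (2 * θ) ≤ √2 - 1) :
    IsPOVM (thetaPOVM θ) := by
  have hγ : (0 : ℂ) ≤ povmGamma θ := by exact_mod_cast (povmGamma_pos h0 h1).le
  have hα : (0 : ℂ) ≤ povmAlpha θ := by exact_mod_cast povmAlpha_nonneg h0 h1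
  have hβ : (0 : ℂ) ≤ povmBeta θ := by
    have : 0 ≤ povmBeta θ := by unfold povmBeta; positivity
    exact_mod_cast this
  obtain ⟨hs, hsc, -⟩ := sin_sq_cos_sq_bounds h0 h1
  refine ⟨fun k => ?_, thetaPOVM_sum (fun h => ?_) (fun h => ?_)⟩
  · fin_cases k
    · exact (posSemidef_outer _).smul hγ
    · exact (posSemidef_outer _).smul hγ
    · exact (posSemidef_outer _).smul hγ
    · exact (posSemidef_outer _).smul hγ
    · exact ((posSemidef_outer _).smul hα).add ((posSemidef_outer _).smul hβ)
    · exact ((posSemidef_outer _).smul hα).add ((posSemidef_outer _).smul hβ)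
  · simp [h] at hs
  · rw [h] at hsc; nlinarith

/-- The sign pairs of the two qubits of a party that are incompatible with the outcome `k`. -/
def eliminates : Fin 6 → Fin 2 → Fin 2 → Bool :=
  ![fun a _ => a = 0, fun _ b => b = 0, fun _ b => b = 1, fun a _ => a = 1, fun a b => a ≠ b,
    fun a b => a = b]

/-- The sequences that the joint outcome `(k, l)` rules out. -/
noncomputable def eliminatedSeqs (k l : Fin 6) : Finset (Fin 2 ↪ Fin 4) :=
  {x | eliminates k (aliceBit (x 0)) (aliceBit (x 1)) ∨
    eliminates l (bobBit (x 0)) (bobBit (x 1))}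

theorem eight_le_card_eliminatedSeqs (k l : Fin 6) : 8 ≤ (eliminatedSeqs k l).card := by
  -- Pairs of indices replace embeddings so that the count can be decided by evaluation.
  let T : Finset (Fin 4 × Fin 4) := {p | p.1 ≠ p.2 ∧
    (eliminates k (aliceBit p.1) (aliceBit p.2) ∨ eliminates l (bobBit p.1) (bobBit p.2))}
  have hT : 8 ≤ T.card := by
    revert k l
    decide +kernel
  have hsub : T ⊆ (eliminatedSeqs k l).image fun x => (x 0, x 1) := by
    rintro ⟨i, j⟩ hp
    obtain ⟨hij, h⟩ := (Finset.mem_filter.1 hp).2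
    refine Finset.mem_image.2 ⟨⟨![i, j], ?_⟩, Finset.mem_filter.2 ⟨Finset.mem_univ _, h⟩, rfl⟩
    intro s t hst
    fin_cases s <;> fin_cases t <;> simp_all
  exact hT.trans ((Finset.card_le_card hsub).trans Finset.card_image_le)

theorem outer_mulVec {α : Type} [Fintype α] (f w : α → ℂ) :
    outer f *ᵥ w = (star f ⬝ᵥ w) • f := by
  rw [outer, Matrix.vecMulVec_mulVec]
  funext i
  simp [mul_comm]

theorem star_ket2_dotProduct (u v a b : Fin 2 → ℂ) :
    star (ket2 u v) ⬝ᵥ ket2 a b = (star u ⬝ᵥ a) * (star v ⬝ᵥ b) := by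
  simp only [dotProduct, sum_fin_two_arrow, Fin.sum_univ_two, ket2, Pi.star_apply, star_mul',
    Matrix.cons_val_zero, Matrix.cons_val_one]
  ring

theorem thetaPOVM_mulVec_eq_zero (θ : ℝ) {k : Fin 6} {a b : Fin 2} (h : eliminates k a b) :
    thetaPOVM θ k *ᵥ ket2 (thetaKet θ a) (thetaKet θ b) = 0 := by
  fin_cases k <;> fin_cases a <;> fin_cases b <;> simp [eliminates] at h <;>
    simp only [thetaPOVM, Matrix.cons_val, Matrix.add_mulVec, Matrix.smul_mulVec, outer_mulVec,
      psi01, psiCS, star_add, star_smul, add_dotProduct, smul_dotProduct, star_ket2_dotProduct,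
      Fin.zero_eta, Fin.mk_one, Fin.reduceFinMk] <;>
    simp [thetaKet, thetaPlus, thetaMinus, ket0, ket1, thetaBarPlus, thetaBarMinus, dotProduct,
      Fin.sum_univ_two, sq, mul_comm, -Complex.ofReal_cos, -Complex.ofReal_sin]

theorem bornProb_mul {α β : Type} [Fintype α] [Fintype β] (E : Matrix α α ℂ) (F : Matrix β β ℂ)
    (u : α → ℂ) (v : β → ℂ) :
    bornProb E F (fun p => u p.1 * v p.2) = (star u ⬝ᵥ (E *ᵥ u)) * (star v ⬝ᵥ (F *ᵥ v)) := by
  have h : (E ⊗ₖ F) *ᵥ (fun p => u p.1 * v p.2) = fun p => (E *ᵥ u) p.1 * (F *ᵥ v) p.2 := by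
    funext p
    simp only [Matrix.mulVec, dotProduct, Matrix.kroneckerMap_apply, Fintype.sum_prod_type,
      Finset.sum_mul_sum]
    exact Finset.sum_congr rfl fun _ _ => Finset.sum_congr rfl fun _ _ => by ring
  rw [bornProb, h]
  simp only [dotProduct, Fintype.sum_prod_type, Finset.sum_mul_sum, Pi.star_apply, star_mul']
  exact Finset.sum_congr rfl fun _ _ => Finset.sum_congr rfl fun _ _ => by ring

theorem bornProb_thetaPOVM_eq_zero (θ : ℝ) (k l : Fin 6) (x : Fin 2 ↪ Fin 4)
    (hx : x ∈ eliminatedSeqs k l) :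
    bornProb (thetaPOVM θ k) (thetaPOVM θ l) (seqState (thetaEnsemble θ) x) = 0 := by
  rw [seqState_thetaEnsemble_two, bornProb_mul]
  rw [eliminatedSeqs, Finset.mem_filter] at hx
  rcases hx.2 with h | h
  · rw [thetaPOVM_mulVec_eq_zero θ h, dotProduct_zero, zero_mul]
  · rw [thetaPOVM_mulVec_eq_zero θ h, dotProduct_zero, mul_zero]

theorem star_dotProduct_outer_mulVec {α : Type} [Fintype α] (f w : α → ℂ) :
    star w ⬝ᵥ (outer f *ᵥ w) = (star f ⬝ᵥ w) * star (star f ⬝ᵥ w) := by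
  rw [outer_mulVec, dotProduct_smul, smul_eq_mul, Matrix.star_dotProduct w f]

theorem exists_bornProb_thetaPOVM_ne_zero {θ : ℝ} (h0 : 0 < Real.cos (2 * θ))
    (h1 : Real.cos (2 * θ) ≤ √2 - 1) (x : Fin 2 ↪ Fin 4) :
    ∃ k l y, x ∈ eliminatedSeqs k l ∧
      bornProb (thetaPOVM θ k) (thetaPOVM θ l) (seqState (thetaEnsemble θ) y) ≠ 0 := by
  obtain ⟨hs, hsc, -⟩ := sin_sq_cos_sq_bounds h0 h1
  have hc : Real.cos θ ≠ 0 := by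
    intro h; rw [h] at hsc; nlinarith
  have hsum : (Real.sin θ * Real.cos θ + Real.cos θ * Real.sin θ : ℂ) ≠ 0 := by
    have hs' : Real.sin θ ≠ 0 := by rintro h; simp [h] at hs
    rw [mul_comm (Real.cos θ : ℂ), ← two_mul]
    exact_mod_cast mul_ne_zero two_ne_zero (mul_ne_zero hs' hc)
  by_cases hx : x 0 = 3
  · refine ⟨3, 3, ⟨![0, 3], by decide⟩, ?_, ?_⟩
    · simp [eliminatedSeqs, eliminates, hx, aliceBit]
    · rw [seqState_thetaEnsemble_two, bornProb_mul]
      simp only [thetaPOVM, Matrix.cons_val, Matrix.smul_mulVec, dotProduct_smul,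
        star_dotProduct_outer_mulVec, star_ket2_dotProduct]
      simp [aliceBit, bobBit, thetaKet, thetaPlus, thetaMinus, ket0, thetaBarMinus, dotProduct,
        Fin.sum_univ_two, -Complex.ofReal_cos, -Complex.ofReal_sin]
      exact ⟨(povmGamma_pos h0 h1).ne', hsum, hc⟩
  · refine ⟨0, 0, ⟨![3, 0], by decide⟩, ?_, ?_⟩
    · have key : ∀ i j : Fin 4, i ≠ 3 → eliminates 0 (aliceBit i) (aliceBit j) ∨
          eliminates 0 (bobBit i) (bobBit j) := by decide
      exact Finset.mem_filter.2 ⟨Finset.mem_univ _, key _ _ hx⟩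
    · rw [seqState_thetaEnsemble_two, bornProb_mul]
      simp only [thetaPOVM, Matrix.cons_val, Matrix.smul_mulVec, dotProduct_smul,
        star_dotProduct_outer_mulVec, star_ket2_dotProduct]
      simp [aliceBit, bobBit, thetaKet, thetaPlus, thetaMinus, ket0, thetaBarPlus, dotProduct,
        Fin.sum_univ_two, -Complex.ofReal_cos, -Complex.ofReal_sin]
      exact ⟨(povmGamma_pos h0 h1).ne', hsum, hc⟩

/-! ### Exchanging `|0⟩` and `|1⟩` -/

/-- The exchange of `|0⟩` and `|1⟩` on each of `n` qubits. -/
def bitFlip (n : ℕ) : Equiv.Perm (Fin n → Fin 2) :=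
  Equiv.arrowCongr (Equiv.refl _) (Equiv.swap 0 1)

theorem IsPOVM.submatrix {α κ : Type} [Fintype α] [DecidableEq α] [Fintype κ]
    {E : κ → Matrix α α ℂ} (hE : IsPOVM E) (e : Equiv.Perm α) :
    IsPOVM fun k => (E k).submatrix e e := by
  refine ⟨fun k => (hE.1 k).submatrix e, ?_⟩
  rw [← Matrix.submatrix_one_equiv e, ← hE.2]
  ext i j
  simp [Matrix.sum_apply]

/-- Replacing `θ` by `π/2 - θ` exchanges sine and cosine; only `|θ₋⟩` acquires a sign, which drops
out of all probabilities. -/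
theorem thetaKet_swap (θ : ℝ) (a i : Fin 2) :
    thetaKet θ a (Equiv.swap 0 1 i) = ![1, -1] a * thetaKet (Real.pi / 2 - θ) a i := by
  fin_cases a <;> fin_cases i <;>
    simp [thetaKet, thetaPlus, thetaMinus, Complex.cos_pi_div_two_sub, Complex.sin_pi_div_two_sub]

theorem bornProb_submatrix_bitFlip (θ : ℝ) (E F : Matrix (Fin 2 → Fin 2) (Fin 2 → Fin 2) ℂ)
    (x : Fin 2 ↪ Fin 4) :
    bornProb (E.submatrix (bitFlip 2) (bitFlip 2)) (F.submatrix (bitFlip 2) (bitFlip 2))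
      (seqState (thetaEnsemble θ) x) =
    bornProb E F (seqState (thetaEnsemble (Real.pi / 2 - θ)) x) := by
  have key (E : Matrix (Fin 2 → Fin 2) (Fin 2 → Fin 2) ℂ) (a b : Fin 2) :
      star (ket2 (thetaKet θ a) (thetaKet θ b)) ⬝ᵥ
        (E.submatrix (bitFlip 2) (bitFlip 2) *ᵥ ket2 (thetaKet θ a) (thetaKet θ b)) =
      star (ket2 (thetaKet (Real.pi / 2 - θ) a) (thetaKet (Real.pi / 2 - θ) b)) ⬝ᵥ
        (E *ᵥ ket2 (thetaKet (Real.pi / 2 - θ) a) (thetaKet (Real.pi / 2 - θ) b)) := by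
    have hket : ket2 (thetaKet θ a) (thetaKet θ b) ∘ (bitFlip 2).symm =
        (![1, -1] a * ![1, -1] b : ℂ) •
          ket2 (thetaKet (Real.pi / 2 - θ) a) (thetaKet (Real.pi / 2 - θ) b) := by
      funext s
      have h (i : Fin 2) : (bitFlip 2).symm s i = Equiv.swap 0 1 (s i) := rfl
      simp only [Function.comp_apply, ket2, h, thetaKet_swap, Pi.smul_apply, smul_eq_mul]
      ring
    have hsign : star (![1, -1] a * ![1, -1] b : ℂ) * (![1, -1] a * ![1, -1] b : ℂ) = 1 := by
      fin_cases a <;> fin_cases b <;> simp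
    rw [Matrix.submatrix_mulVec_equiv, ← comp_equiv_symm_dotProduct]
    change star (ket2 (thetaKet θ a) (thetaKet θ b) ∘ (bitFlip 2).symm) ⬝ᵥ _ = _
    rw [hket, Matrix.mulVec_smul, star_smul, smul_dotProduct, dotProduct_smul, smul_smul, hsign,
      one_smul]
  rw [seqState_thetaEnsemble_two, seqState_thetaEnsemble_two, bornProb_mul, bornProb_mul, key, key]

theorem isStrongLSAM_thetaEnsemble_two (θ : ℝ) (hθ0 : Real.cos (2 * θ) ≠ 0)
    (hθ : |Real.cos (2 * θ)| ≤ √2 - 1) : IsStrongLSAM (thetaEnsemble θ) 2 8 := by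
  obtain ⟨hneg, hpos⟩ := abs_le.1 hθ
  rcases hθ0.lt_or_gt with h0 | h0
  · have hcos : Real.cos (2 * (Real.pi / 2 - θ)) = -Real.cos (2 * θ) := by
      rw [← Real.cos_pi_sub]; congr 1; ring
    have h0' : 0 < Real.cos (2 * (Real.pi / 2 - θ)) := by linarith
    have h1' : Real.cos (2 * (Real.pi / 2 - θ)) ≤ √2 - 1 := by linarith
    have hE := (isPOVM_thetaPOVM h0' h1').submatrix (bitFlip 2)
    refine isStrongLSAM_of_isPOVM hE hE eliminatedSeqs eight_le_card_eliminatedSeqs ?_ ?_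
    · intro k l x hx
      rw [bornProb_submatrix_bitFlip]
      exact bornProb_thetaPOVM_eq_zero _ k l x hx
    · intro x
      simp only [bornProb_submatrix_bitFlip]
      exact exists_bornProb_thetaPOVM_ne_zero h0' h1' x
  · have hE := isPOVM_thetaPOVM h0 hpos
    exact isStrongLSAM_of_isPOVM hE hE eliminatedSeqs eight_le_card_eliminatedSeqs
      (bornProb_thetaPOVM_eq_zero θ) (exists_bornProb_thetaPOVM_ne_zero h0 hpos)

/-- For `0 < |cos 2θ| ≤ √2 - 1`, the ensemble `|θ±⟩|θ±⟩` does not admit `(1, 2)`-LSAM, but admits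
`(2, 8)`-LSAM, even in the strong sense. For `cos 2θ > 0` the latter is achieved by each party
performing the six-outcome measurement `thetaPOVM θ`: every joint outcome `(k, l)` eliminates at
least eight of the twelve sequences. -/
theorem mainTheorem10 (θ : ℝ) (hθ0 : Real.cos (2 * θ) ≠ 0)
    (hθ : |Real.cos (2 * θ)| ≤ √2 - 1) :
    ¬ IsLSAM (thetaEnsemble θ) 1 2 ∧
    IsStrongLSAM (thetaEnsemble θ) 2 8 ∧
    (0 < Real.cos (2 * θ) →
      IsPOVM (thetaPOVM θ) ∧
      ∃ X : Fin 6 → Fin 6 → Finset (Fin 2 ↪ Fin 4), ∀ k l,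
        8 ≤ (X k l).card ∧
        ∀ x ∈ X k l,
          bornProb (thetaPOVM θ k) (thetaPOVM θ l) (seqState (thetaEnsemble θ) x) = 0) := by
  refine ⟨not_isLSAM_thetaEnsemble_one θ hθ0 two_pos, isStrongLSAM_thetaEnsemble_two θ hθ0 hθ,
    fun h0 => ⟨isPOVM_thetaPOVM h0 (abs_le.1 hθ).2, eliminatedSeqs, fun k l =>
      ⟨eight_le_card_eliminatedSeqs k l, bornProb_thetaPOVM_eq_zero θ k l⟩⟩⟩
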